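/- Theorem. Let $\phi:\mathbb{R}^d\to\mathbb{R}$ be differentiable and, for constants $0<m\le M$, let it be $m$-strongly convex with $M$-Lipschitz gradient, i.e. $m\|x-y\|^2\le(\nabla\phi(x)-\nabla\phi(y))^T(x-y)\le M\|x-y\|^2$ for all $x,y\in\mathbb{R}^d$. Let $\phi^*=\min\phi$. Let $\epsilon_f,\epsilon_g\ge 0$ and let $f:\mathbb{R}^d\to\mathbb{R}$, $g:\mathbb{R}^d\to\mathbb{R}^d$ satisfy $|\phi(x)-f(x)|\le\epsilon_f$ and $\|\nabla\phi(x)-g(x)\|\le\epsilon_g$ for all $x$. Let $0<c_1<c_2<1$ and $c_3>0$. Let $\{x_k\}_{k\ge0}$ be generated, from any $x_0$ and any symmetric positive definite $H_0$, by the noise-tolerant BFGS or L-BFGS algorithm. That is, for $k=0,1,2,\dots$: 1. $p_k=-H_kg(x_k)$. 2. $x_{k+1}=x_k+\alpha_kp_k$, where $\alpha_k\ge 0$ either satisfies the Armijo and Wolfe conditions $$f(x_k+\alpha_kp_k)\le f(x_k)+c_1\alpha_kg(x_k)^Tp_k,\qquad g(x_k+\alpha_kp_k)^Tp_k\ge c_2\,g(x_k)^Tp_k,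 \tag{1}$$ or, if the line search fails to find such a step, satisfies $f(x_k+\alpha_kp_k)\le f(x_k)$. 3. $\beta_k>0$ satisfies the noise control condition $(g(x_k+\beta_kp_k)-g(x_k))^Tp_k\ge 2(1+c_3)\epsilon_g\|p_k\|$, and $s_k=\beta_kp_k$, $y_k=g(x_k+\beta_kp_k)-g(x_k)$. 4. In BFGS, $H_{k+1}=(I-r_ks_ky_k^T)H_k(I-r_ky_ks_k^T)+r_ks_ks_k^T$ with $r_k=1/(y_k^Ts_k)$. In L-BFGS with memory $t\ge1$, for each $k\ge1$ the matrix $H_k$ results from $\frac{s_{k-1}^Ty_{k-1}}{y_{k-1}^Ty_{k-1}}I$ by applying this update successively with the pairs $(s_i,y_i)$, $i=k-\min(t,k),\dots,k-1$. (If $g(x_k)=0$, then $p_k=0$ and the iterates stay at $x_k$ from then on; the later matrices play no role.) Let $\theta_k$ be the angle between $p_k$ and $-g(x_k)$, with the convention $\cos\theta_k=1$ if $g(x_k)=0$, and for $\gamma>0$ let $J(\gamma)=\{k\in\mathbb{N}:\cos\theta_k\ge\gamma\}$ be the set of good iterates. Let $q^*\in(0,1)$. Then there is $\gamma^*>0$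 such that $$|J(\gamma^*)\cap[0,k-1]|\ge q^*k\qquad\text{for all }k\in\mathbb{N}. \tag{2}$$ For any $\gamma^*>0$ satisfying (2), define $$\mathcal N_1=\Big\{x:\ \|\nabla\phi(x)\|\le\max\Big\{A\frac{\sqrt{M\epsilon_f}}{\gamma^*},\,B\frac{\epsilon_g}{\gamma^*}\Big\}\Big\},\qquad \mathcal N_2=\Big\{x:\ \phi(x)\le 2\epsilon_f+\max_{y\in\mathcal N_1}\phi(y)\Big\},$$ $$A=\max\Big\{\frac{16\sqrt2}{\sqrt{(c_2-c_1)(4-c_1-3c_2)}},\frac{8}{\sqrt{c_1(1-c_2)}}\Big\},\qquad B=\max\Big\{\frac{8}{1-c_2},\frac{8(1+c_1)}{c_2-c_1}+6\Big\},$$ and let $K=\min\{k\in\mathbb{N}:x_k\in\mathcal N_1\}$ ($K=\infty$ if there is no such $k$). Suppose that for every $k\in J(\gamma^*)$ with $x_k\notin\mathcal N_1$ the line search finds $\alpha_k$ satisfying (1). Then: (a) the maximum defining $\mathcal N_2$ is attained, and $\mathcal N_1\subseteq\mathcal N_2$; (b) there is $\rho\in(0,1)$ such that $\phi(x_k)-\phi^*\le\rho^k(\phi(x_0)-\phi^*)+2\epsilon_f$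 for all $k<K$; (c) if $\epsilon_f>0$ or $\epsilon_g>0$, then $K<\infty$; (d) $x_k\in\mathcal N_2$ for all $k\ge K$. -/

import Mathlib

noncomputable section

namespace NoisyBFGS

/-- The space `ℝᵈ` with the Euclidean norm. -/
abbrev E (d : ℕ) : Type := EuclideanSpace ℝ (Fin d)

/-- Real `d × d` matrices. -/
abbrev Mat (d : ℕ) : Type := Matrix (Fin d) (Fin d) ℝ

/-- `φ` is differentiable, `m`-strongly convex and has an `M`-Lipschitz gradient, expressed by
`m ‖x - y‖² ≤ (∇φ(x) - ∇φ(y))ᵀ (x - y) ≤ M ‖x - y‖²` for all `x, y`, with `0 < m ≤ M`. -/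
structure StronglyConvexSmooth {d : ℕ} (φ : E d → ℝ) (m M : ℝ) : Prop where
  differentiable : Differentiable ℝ φ
  m_pos : 0 < m
  m_le_M : m ≤ M
  lower : ∀ x y : E d, m * ‖x - y‖ ^ 2 ≤ inner ℝ (gradient φ x - gradient φ y) (x - y)
  upper : ∀ x y : E d, inner ℝ (gradient φ x - gradient φ y) (x - y) ≤ M * ‖x - y‖ ^ 2

/-- The errors in the function and gradient evaluations are bounded by `εf` and `εg`. -/
structure BoundedErrors {d : ℕ} (φ f : E d → ℝ) (g : E d → E d) (εf εg : ℝ) : Prop where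
  εf_nonneg : 0 ≤ εf
  εg_nonneg : 0 ≤ εg
  function_error : ∀ x, |φ x - f x| ≤ εf
  gradient_error : ∀ x, ‖gradient φ x - g x‖ ≤ εg

/-- Armijo condition. -/
def Armijo {d : ℕ} (f : E d → ℝ) (g : E d → E d) (c₁ : ℝ) (x p : E d) (α : ℝ) : Prop :=
  f (x + α • p) ≤ f x + c₁ * α * inner ℝ (g x) p

/-- Wolfe condition. -/
def Wolfe {d : ℕ} (g : E d → E d) (c₂ : ℝ) (x p : E d) (α : ℝ) : Prop :=
  c₂ * inner ℝ (g x) p ≤ inner ℝ (g (x + α • p)) p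

/-- Noise control condition. -/
def NoiseControl {d : ℕ} (g : E d → E d) (c₃ εg : ℝ) (x p : E d) (β : ℝ) : Prop :=
  2 * (1 + c₃) * εg * ‖p‖ ≤ inner ℝ (g (x + β • p) - g x) p

/-- The BFGS update `(I - r s yᵀ) H (I - r y sᵀ) + r s sᵀ` of an inverse Hessian approximation,
with `r = 1 / yᵀs`. -/
def bfgsUpdate {d : ℕ} (H : Mat d) (s y : E d) : Mat d :=
  (1 - (1 / inner ℝ y s : ℝ) • Matrix.vecMulVec s y) * H *
      (1 - (1 / inner ℝ y s : ℝ) • Matrix.vecMulVec y s) +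
    (1 / inner ℝ y s : ℝ) • Matrix.vecMulVec s s

/-- The result of updating `H₀` successively with the first `n` pairs
`(s 0, y 0), …, (s (n - 1), y (n - 1))`. -/
def bfgsIterate {d : ℕ} (H₀ : Mat d) (s y : ℕ → E d) : ℕ → Mat d
  | 0 => H₀
  | n + 1 => bfgsUpdate (bfgsIterate H₀ s y n) (s n) (y n)

/-- The L-BFGS matrix at iteration `k ≥ 1` with memory `t`: starting from `γₖ I` with
`γₖ = sₖ₋₁ᵀyₖ₋₁ / yₖ₋₁ᵀyₖ₋₁`, apply the BFGS updates with the stored pairs, i.e. the last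
`min t k` ones, from the oldest, of index `k - min t k`, to the newest, of index `k - 1`. -/
def lbfgsMatrix {d : ℕ} (t : ℕ) (s y : ℕ → E d) (k : ℕ) : Mat d :=
  bfgsIterate ((inner ℝ (s (k - 1)) (y (k - 1)) / inner ℝ (y (k - 1)) (y (k - 1)) : ℝ) • 1)
    (fun i => s (k - min t k + i)) (fun i => y (k - min t k + i)) (min t k)

/-- The standard BFGS choice of the inverse Hessian approximations. -/
def IsBFGS {d : ℕ} (H : ℕ → Mat d) (s y : ℕ → E d) : Prop :=
  ∀ k, H (k + 1) = bfgsUpdate (H k) (s k) (y k)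

/-- The L-BFGS choice, with memory `t`, of the inverse Hessian approximations. -/
def IsLBFGS {d : ℕ} (t : ℕ) (H : ℕ → Mat d) (s y : ℕ → E d) : Prop :=
  ∀ k, 1 ≤ k → H k = lbfgsMatrix t s y k

/-- The sequences `x, p, α, β, s, y, H` are generated by the noise-tolerant BFGS method or by the
noise-tolerant L-BFGS method with some memory `t ≥ 1`.  (If `g (x k) = 0` then `p k = 0` and
`x (k + 1) = x k`, so that the iterates stay at `x k`, whatever the matrices are from then on.) -/
structure IsRun {d : ℕ} (f : E d → ℝ) (g : E d → E d) (c₁ c₂ c₃ εg : ℝ)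
    (x p : ℕ → E d) (α β : ℕ → ℝ) (s y : ℕ → E d) (H : ℕ → Mat d) : Prop where
  H_zero : (H 0).PosDef
  direction : ∀ k, p k = -Matrix.toEuclideanLin (H k) (g (x k))
  α_nonneg : ∀ k, 0 ≤ α k
  /-- Armijo-Wolfe step, or simple decrease of `f` after a failure of the line search. -/
  line_search : ∀ k, (Armijo f g c₁ (x k) (p k) (α k) ∧ Wolfe g c₂ (x k) (p k) (α k)) ∨
    f (x k + α k • p k) ≤ f (x k)
  step : ∀ k, x (k + 1) = x k + α k • p k
  β_pos : ∀ k, 0 < β k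
  lengthening : ∀ k, NoiseControl g c₃ εg (x k) (p k) (β k)
  pair_s : ∀ k, s k = β k • p k
  pair_y : ∀ k, y k = g (x k + β k • p k) - g (x k)
  update : IsBFGS H s y ∨ ∃ t, 1 ≤ t ∧ IsLBFGS t H s y

open Classical in
/-- `cos θ`, where `θ` is the angle between the direction `p` and `-v`, with the convention
`cos θ = 1` for `v = 0`. -/
def cosAngle {d : ℕ} (p v : E d) : ℝ :=
  if v = 0 then 1 else Real.cos (InnerProductGeometry.angle p (-v))

/-- The set `J(γ)` of good iterates. -/
def goodIterates {d : ℕ} (g : E d → E d) (x p : ℕ → E d) (γ : ℝ) : Set ℕ :=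
  {k | γ ≤ cosAngle (p k) (g (x k))}

/-- `|J(γ) ∩ [0, k - 1]| ≥ q k` for all `k`. -/
def GoodFraction {d : ℕ} (g : E d → E d) (x p : ℕ → E d) (q γ : ℝ) : Prop :=
  ∀ k : ℕ, q * (k : ℝ) ≤ ((goodIterates g x p γ ∩ Set.Iio k).ncard : ℝ)

/-- The constant `A`. -/
def constA (c₁ c₂ : ℝ) : ℝ :=
  max (16 * √2 / √((c₂ - c₁) * (4 - c₁ - 3 * c₂))) (8 / √(c₁ * (1 - c₂)))

/-- The constant `B`. -/
def constB (c₁ c₂ : ℝ) : ℝ :=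
  max (8 / (1 - c₂)) (8 * (1 + c₁) / (c₂ - c₁) + 6)

/-- The neighbourhood `N₁`. -/
def N₁ {d : ℕ} (φ : E d → ℝ) (M c₁ c₂ εf εg γ : ℝ) : Set (E d) :=
  {x | ‖gradient φ x‖ ≤ max (constA c₁ c₂ * √(M * εf) / γ) (constB c₁ c₂ * εg / γ)}

/-- The neighbourhood `N₂` of a set `N`; the supremum is a maximum when `φ` attains its maximum
on `N`. -/
def N₂ {d : ℕ} (φ : E d → ℝ) (εf : ℝ) (N : Set (E d)) : Set (E d) :=
  {x | φ x ≤ 2 * εf + sSup (φ '' N)}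

/-- The index of the first iterate in `N`, equal to `⊤` if there is none. -/
def firstEntry {d : ℕ} (x : ℕ → E d) (N : Set (E d)) : ℕ∞ :=
  sInf ((fun k : ℕ => (k : ℕ∞)) '' {k | x k ∈ N})

end NoisyBFGS

end

namespace NoisyBFGS

open Matrix

/-! Noise changes a gradient difference by at most `2 * εg`, so noise control makes the error in
`yᵀs` at most a fraction `1 / (1 + c₃)` of `yᵀs`. Every pair therefore inherits from `φ` bounds
`μ‖s‖² ≤ yᵀs` and `‖y‖² ≤ L yᵀs` (`exists_curvaturePair`). With these, the Byrd-Nocedal potential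
`tr B - log det B` of `B = H⁻¹`, which is nonnegative, changes in one update by at most a constant
plus `2 log cos θ` (`potential_update_le`, `cosAngle_pos_and_potential_le`). For BFGS this
telescopes: the sum of `-log cos θ` grows at most linearly, and Markov's inequality bounds the
cosine below on a fraction `q` of the iterates. For L-BFGS the potential is bounded uniformly as
long as `g` does not vanish, and then all iterates are good. At a good iterate outside `N₁` the
gradient dominates the noise, so an Armijo-Wolfe step lowers the noisy `f` by a multiple of `‖∇φ‖²`
(`armijo_wolfe_decrease`). With the Polyak-Łojasiewicz inequality, `f - φ* - εf` contracts there; at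
the other iterates `f` does not increase, as every direction is of descent or zero. Working with `f`
pays for the noise only twice, at the start and at the end, whence `2 * εf`. If `N₁` were never
entered, the limit would give `‖∇φ‖² ≤ 4 M εf` asymptotically, below the squared threshold of `N₁`.
After entry, monotonicity of `f` keeps the iterates in `N₂`. -/

theorem vecMulVec_mulVec_eq_smul {ι : Type*} [Fintype ι] (u v w : ι → ℝ) : vecMulVec u v *ᵥ w = (v ⬝ᵥ w) • u := by
  rw [vecMulVec_mulVec]; ext i; simp [mul_comm]

/-! ### Algebra of the BFGS update: positivity, inverse, determinant. -/

variable {ι : Type*} [Fintype ι] [DecidableEq ι]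

/-- The BFGS update of `H` with plain vectors in place of elements of the Euclidean space. -/
noncomputable def updateMatrix (H : Matrix ι ι ℝ) (s y : ι → ℝ) : Matrix ι ι ℝ :=
  (1 - (y ⬝ᵥ s)⁻¹ • vecMulVec s y) * H * (1 - (y ⬝ᵥ s)⁻¹ • vecMulVec y s) +
    (y ⬝ᵥ s)⁻¹ • vecMulVec s s

theorem bfgsUpdate_eq {d : ℕ} (H : Mat d) (s y : E d) :
    bfgsUpdate H s y = updateMatrix H s.ofLp y.ofLp := by
  unfold bfgsUpdate updateMatrix
  rw [EuclideanSpace.inner_eq_star_dotProduct, dotProduct_comm]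
  simp

theorem updateMatrix_mulVec (H : Matrix ι ι ℝ) (s y v : ι → ℝ) :
    updateMatrix H s y *ᵥ v =
      H *ᵥ (v - ((y ⬝ᵥ s)⁻¹ * (s ⬝ᵥ v)) • y) -
        ((y ⬝ᵥ s)⁻¹ * (y ⬝ᵥ (H *ᵥ (v - ((y ⬝ᵥ s)⁻¹ * (s ⬝ᵥ v)) • y)))) • s +
        ((y ⬝ᵥ s)⁻¹ * (s ⬝ᵥ v)) • s := by
  simp only [updateMatrix, add_mulVec, ← mulVec_mulVec, sub_mulVec, one_mulVec, smul_mulVec,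
    vecMulVec_mulVec_eq_smul, smul_smul]

theorem updateMatrix_isHermitian {H : Matrix ι ι ℝ} (hH : H.IsHermitian) (s y : ι → ℝ) :
    (updateMatrix H s y).IsHermitian := by
  have h : ∀ u v : ι → ℝ, (vecMulVec u v)ᴴ = vecMulVec v u := fun u v => by
    ext i j; simp [vecMulVec_apply, mul_comm]
  rw [IsHermitian, updateMatrix]
  simp only [conjTranspose_add, conjTranspose_mul, conjTranspose_sub, conjTranspose_smul, h,
    conjTranspose_one, hH.eq, star_trivial, mul_assoc]

/-- With `w = v - r (sᵀv) y` the quadratic form is `wᵀHw + r (sᵀv)²`; if the second term vanishes,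
then `w = v`. -/
theorem updateMatrix_posDef {H : Matrix ι ι ℝ} (hH : H.PosDef) {s y : ι → ℝ} (hys : 0 < y ⬝ᵥ s) :
    (updateMatrix H s y).PosDef := by
  refine PosDef.of_dotProduct_mulVec_pos (updateMatrix_isHermitian hH.1 s y) fun v hv => ?_
  rw [updateMatrix_mulVec, star_trivial]
  set r := (y ⬝ᵥ s)⁻¹ with hr
  have hr0 : 0 < r := inv_pos.2 hys
  set w := v - (r * (s ⬝ᵥ v)) • y with hw
  have key : v ⬝ᵥ (H *ᵥ w - (r * (y ⬝ᵥ (H *ᵥ w))) • s + (r * (s ⬝ᵥ v)) • s) =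
      w ⬝ᵥ (H *ᵥ w) + r * (s ⬝ᵥ v) ^ 2 := by
    have : w ⬝ᵥ (H *ᵥ w) = v ⬝ᵥ (H *ᵥ w) - (r * (s ⬝ᵥ v)) * (y ⬝ᵥ (H *ᵥ w)) := by
      conv_lhs => rw [hw, sub_dotProduct, smul_dotProduct, ← hw]
      simp
    rw [this]
    simp only [dotProduct_add, dotProduct_sub, dotProduct_smul, smul_eq_mul, dotProduct_comm v s]
    ring
  rw [key]
  by_cases hsv : s ⬝ᵥ v = 0
  · have : w = v := by simp [hw, hsv]
    rw [this, hsv]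
    simpa using hH.dotProduct_mulVec_pos hv
  · have h1 : 0 ≤ w ⬝ᵥ (H *ᵥ w) := by simpa using hH.posSemidef.dotProduct_mulVec_nonneg w
    positivity

/-- The direct BFGS formula for `B = H⁻¹`. Writing `s = H b` makes `b = B s` explicit; in the
algorithm `b` is a negative multiple of the noisy gradient. -/
theorem updateMatrix_inv {H : Matrix ι ι ℝ} (hH : H.PosDef) {b y : ι → ℝ}
    (hσ : (H *ᵥ b) ⬝ᵥ b ≠ 0) (hys : y ⬝ᵥ (H *ᵥ b) ≠ 0) :
    (updateMatrix H (H *ᵥ b) y)⁻¹ =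
      H⁻¹ - ((H *ᵥ b) ⬝ᵥ b)⁻¹ • vecMulVec b b + (y ⬝ᵥ (H *ᵥ b))⁻¹ • vecMulVec y y := by
  have hT : Hᵀ = H := by simpa [IsHermitian, conjTranspose_eq_transpose_of_trivial] using hH.1
  have hinv : H⁻¹ * H = 1 := nonsing_inv_mul _ ((isUnit_iff_isUnit_det H).1 hH.isUnit)
  refine inv_eq_left_inv ?_
  set s := H *ᵥ b with hs
  set r := (y ⬝ᵥ s)⁻¹ with hr
  set σ := s ⬝ᵥ b with hσd
  have hBs : H⁻¹ *ᵥ s = b := by rw [hs, mulVec_mulVec, hinv, one_mulVec]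
  have hsym : ∀ u : ι → ℝ, u ᵥ* H = H *ᵥ u := fun u => by rw [← mulVec_transpose, hT]
  have hrow : ∀ u : ι → ℝ, u ᵥ* updateMatrix H s y = H *ᵥ u - (r * (u ⬝ᵥ s)) • (H *ᵥ y)
      - (r * (u ⬝ᵥ (H *ᵥ y)) - r * (u ⬝ᵥ s) * (r * (y ⬝ᵥ (H *ᵥ y)))) • s
      + (r * (u ⬝ᵥ s)) • s := fun u => by
    simp only [updateMatrix, vecMul_add, ← vecMul_vecMul, vecMul_sub, vecMul_one, vecMul_smul,
      vecMul_vecMulVec, hsym, mulVec_sub, mulVec_smul, sub_dotProduct, smul_dotProduct,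
      smul_eq_mul, dotProduct_comm (H *ᵥ u) y, dotProduct_comm (H *ᵥ y) y, ← hr]
    have : y ⬝ᵥ (H *ᵥ u) = u ⬝ᵥ (H *ᵥ y) := by
      rw [dotProduct_mulVec, hsym, dotProduct_comm]
    rw [this]
    module
  have hbw : b ⬝ᵥ (H *ᵥ y) = y ⬝ᵥ s := by
    rw [dotProduct_mulVec, hsym, ← hs, dotProduct_comm]
  have hB : H⁻¹ * updateMatrix H s y = 1 - r • vecMulVec b (H *ᵥ y) - r • vecMulVec y s +
      (r * r * (y ⬝ᵥ (H *ᵥ y)) + r) • vecMulVec b s := by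
    have e1 : H⁻¹ * (1 - r • vecMulVec s y) * H = 1 - r • vecMulVec b (H *ᵥ y) := by
      rw [mul_sub, mul_one, sub_mul, hinv, mul_smul_comm, mul_vecMulVec, hBs, smul_mul_assoc,
        vecMulVec_mul,
        hsym]
    rw [updateMatrix, mul_add, ← hr, ← mul_assoc, ← mul_assoc, e1, mul_smul_comm, mul_vecMulVec,
      hBs]
    have e2 : vecMulVec b (H *ᵥ y) * vecMulVec y s = (y ⬝ᵥ (H *ᵥ y)) • vecMulVec b s := by
      rw [vecMulVec_mul, vecMul_vecMulVec, vecMulVec_smul, dotProduct_comm]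
    rw [mul_sub, mul_one, sub_mul, one_mul, smul_mul_assoc, mul_smul_comm, e2]
    module
  have hry : r * (y ⬝ᵥ s) = 1 := inv_mul_cancel₀ hys
  have hσσ : σ⁻¹ * σ = 1 := inv_mul_cancel₀ hσ
  rw [add_mul, sub_mul, hB, smul_mul_assoc, smul_mul_assoc, vecMulVec_mul, vecMulVec_mul, hrow, hrow, hry,
    dotProduct_comm b s, ← hσd, hbw, hry, ← hs]
  have e3 : H *ᵥ y - (1 : ℝ) • H *ᵥ y - (r * y ⬝ᵥ H *ᵥ y - 1 * (r * y ⬝ᵥ H *ᵥ y)) • s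
      + (1 : ℝ) • s = s := by module
  rw [e3]
  have e4 : s - (r * σ) • H *ᵥ y - (1 - r * σ * (r * y ⬝ᵥ H *ᵥ y)) • s + (r * σ) • s
      = σ • ((r * r * (y ⬝ᵥ (H *ᵥ y)) + r) • s - r • H *ᵥ y) := by module
  rw [e4, vecMulVec_smul, smul_smul, hσσ, one_smul, vecMulVec_sub,
    vecMulVec_smul, vecMulVec_smul]
  module

/-- The new `B` times the old `H` is the identity plus a rank-two product `U * W`, so Sylvester's
identity leaves a 2 × 2 determinant, whose upper left entry is zero. -/
theorem updateMatrix_det {H : Matrix ι ι ℝ} (hH : H.PosDef) {b y : ι → ℝ}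
    (hσ : 0 < (H *ᵥ b) ⬝ᵥ b) (hys : 0 < y ⬝ᵥ (H *ᵥ b)) :
    (updateMatrix H (H *ᵥ b) y).det = H.det * ((H *ᵥ b) ⬝ᵥ b / y ⬝ᵥ (H *ᵥ b)) := by
  have hT : Hᵀ = H := by simpa [IsHermitian, conjTranspose_eq_transpose_of_trivial] using hH.1
  have hinv : H⁻¹ * H = 1 := nonsing_inv_mul _ ((isUnit_iff_isUnit_det H).1 hH.isUnit)
  have hI := updateMatrix_inv hH hσ.ne' hys.ne'
  set s := H *ᵥ b with hs
  set r := (y ⬝ᵥ s)⁻¹ with hr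
  set σ := s ⬝ᵥ b with hσd
  set w := H *ᵥ y with hw
  have hsym : ∀ u : ι → ℝ, u ᵥ* H = H *ᵥ u := fun u => by rw [← mulVec_transpose, hT]
  have hbw : b ⬝ᵥ w = y ⬝ᵥ s := by rw [hw, dotProduct_mulVec, hsym, ← hs, dotProduct_comm]
  let U : Matrix ι (Fin 2) ℝ := Matrix.of fun i => ![-(σ⁻¹) * b i, r * y i]
  let W : Matrix (Fin 2) ι ℝ := Matrix.of ![s, w]
  have hUW : (updateMatrix H s y)⁻¹ * H = 1 + U * W := by
    rw [hI, add_mul, sub_mul, hinv, smul_mul_assoc, smul_mul_assoc, vecMulVec_mul, vecMulVec_mul, hsym, hsym,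
      ← hs, ← hw, sub_add, sub_eq_add_neg]
    congr 1
    ext i j
    simp [U, W, Matrix.mul_apply, Fin.sum_univ_two, vecMulVec_apply]
    ring
  have hdet : (1 + U * W).det = (y ⬝ᵥ s) / σ := by
    have e : ∀ (c : ℝ) (u v : ι → ℝ), ∑ j, u j * (c * v j) = c * (u ⬝ᵥ v) := fun c u v => by
      rw [dotProduct, Finset.mul_sum]; exact Finset.sum_congr rfl fun _ _ => by ring
    have e00 : (W * U) 0 0 = -(σ⁻¹) * (s ⬝ᵥ b) := e _ _ _
    have e01 : (W * U) 0 1 = r * (s ⬝ᵥ y) := e _ _ _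
    have e10 : (W * U) 1 0 = -(σ⁻¹) * (w ⬝ᵥ b) := e _ _ _
    have e11 : (W * U) 1 1 = r * (w ⬝ᵥ y) := e _ _ _
    rw [det_one_add_mul_comm, det_fin_two]
    simp only [Matrix.add_apply, e00, e01, e10, e11, one_apply_eq, dotProduct_comm w b,
      dotProduct_comm s y, hbw, ← hσd]
    rw [one_apply_ne (by decide), one_apply_ne (by decide)]
    simp only [hr]
    field_simp
    ring
  have hd := congrArg det hUW
  rw [det_mul, hdet, det_nonsing_inv, Ring.inverse_eq_inv'] at hd
  have hd0 := (updateMatrix_posDef hH hys).det_pos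
  have hH0 := hH.det_pos
  field_simp at hd ⊢
  linarith

/-! ### The potential and its growth in one update. -/

/-- The Byrd-Nocedal potential `tr B - log (det B)` of `B = H⁻¹`. -/
noncomputable def potential (H : Matrix ι ι ℝ) : ℝ := H⁻¹.trace + Real.log H.det

/-- Sum `log λ ≤ λ - 1` over the eigenvalues of `H⁻¹`. -/
theorem potential_nonneg {H : Matrix ι ι ℝ} (hH : H.PosDef) : 0 ≤ potential H := by
  have hB := hH.inv
  have hdet : H.det = (H⁻¹.det)⁻¹ := by
    rw [det_nonsing_inv, Ring.inverse_eq_inv', inv_inv]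
  rw [potential, hdet, Real.log_inv, hB.1.trace_eq_sum_eigenvalues, hB.1.det_eq_prod_eigenvalues]
  simp only [RCLike.ofReal_real_eq_id, id]
  rw [Real.log_prod fun i _ => (hB.eigenvalues_pos i).ne', ← sub_eq_add_neg,
    ← Finset.sum_sub_distrib]
  exact Finset.sum_nonneg fun i _ => by
    linarith [Real.log_le_sub_one_of_pos (hB.eigenvalues_pos i)]

/-- The last term is `log cos²` of the angle between `s = H b` and `b`. It arises by bounding the
trace loss `‖b‖² / sᵀb` from below by `1` plus its logarithm. -/
theorem potential_update_le {H : Matrix ι ι ℝ} (hH : H.PosDef) {b y : ι → ℝ} (hb : b ≠ 0)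
    {μ L : ℝ} (hμ : 0 < μ) (h1 : μ * ((H *ᵥ b) ⬝ᵥ (H *ᵥ b)) ≤ y ⬝ᵥ (H *ᵥ b))
    (h2 : y ⬝ᵥ y ≤ L * (y ⬝ᵥ (H *ᵥ b))) :
    potential (updateMatrix H (H *ᵥ b) y) ≤ potential H + (L - Real.log μ) +
      Real.log (((H *ᵥ b) ⬝ᵥ b) ^ 2 / (((H *ᵥ b) ⬝ᵥ (H *ᵥ b)) * (b ⬝ᵥ b))) := by
  have hσ : 0 < (H *ᵥ b) ⬝ᵥ b := by
    rw [dotProduct_comm]; simpa using hH.dotProduct_mulVec_pos hb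
  have hpos : ∀ v : ι → ℝ, v ≠ 0 → 0 < v ⬝ᵥ v := fun v hv => by
    simpa using dotProduct_star_self_pos_iff.2 hv
  have hs0 : H *ᵥ b ≠ 0 := fun h => by simp [h] at hσ
  have hss := hpos _ hs0
  have hbb := hpos _ hb
  have hys : 0 < y ⬝ᵥ (H *ᵥ b) := lt_of_lt_of_le (by positivity) h1
  rw [potential, updateMatrix_inv hH hσ.ne' hys.ne', updateMatrix_det hH hσ hys]
  have hH0 := hH.det_pos
  set s := H *ᵥ b
  rw [potential, trace_add, trace_sub, trace_smul, trace_smul, trace_vecMulVec, trace_vecMulVec,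
    Real.log_mul hH0.ne' (by positivity), Real.log_div hσ.ne' hys.ne',
    Real.log_div (by positivity) (by positivity), Real.log_mul hss.ne' hbb.ne', Real.log_pow]
  have l1 : Real.log μ + Real.log (s ⬝ᵥ s) ≤ Real.log (y ⬝ᵥ s) := by
    rw [← Real.log_mul hμ.ne' hss.ne']; exact Real.log_le_log (by positivity) h1
  have l2 : (y ⬝ᵥ s)⁻¹ • (y ⬝ᵥ y) ≤ L := by
    rw [smul_eq_mul, inv_mul_le_iff₀ hys]; linarith
  have l3 := Real.log_le_sub_one_of_pos (div_pos hbb hσ)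
  rw [Real.log_div hbb.ne' hσ.ne'] at l3
  have l4 : (s ⬝ᵥ b)⁻¹ • (b ⬝ᵥ b) = (b ⬝ᵥ b) / (s ⬝ᵥ b) := by
    rw [smul_eq_mul, inv_mul_eq_div]
  rw [l4]
  push_cast
  linarith

theorem potential_smul_one {c : ℝ} (hc : 0 < c) :
    potential (c • (1 : Matrix ι ι ℝ)) = Fintype.card ι * (c⁻¹ + Real.log c) := by
  have h : (c • (1 : Matrix ι ι ℝ))⁻¹ = c⁻¹ • 1 :=
    inv_eq_left_inv (by rw [smul_mul_smul_comm, inv_mul_cancel₀ hc.ne', one_smul, one_mul])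
  rw [potential, h, trace_smul, trace_one, det_smul, det_one, mul_one, Real.log_pow, smul_eq_mul]
  ring

/-! ### Strongly convex functions with smooth gradient. -/

section Convex

variable {d : ℕ} {φ : E d → ℝ} {m M : ℝ}

/-- The difference of the two sides along the segment is monotone. The sign of `c` is free: `-φ`
with `c = -M` gives the quadratic upper bound. -/
theorem quadratic_lower_bound {F : Type*} [NormedAddCommGroup F] [InnerProductSpace ℝ F]
    [CompleteSpace F] {φ : F → ℝ} {G : F → F} (hG : ∀ z, HasGradientAt φ (G z) z) {c : ℝ}
    (hc : ∀ x y, c * ‖x - y‖ ^ 2 ≤ inner ℝ (G x - G y) (x - y)) (x v : F) :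
    φ x + inner ℝ (G x) v + c / 2 * ‖v‖ ^ 2 ≤ φ (x + v) := by
  set h : ℝ → ℝ := fun t => φ (x + t • v) - t * inner ℝ (G x) v - c / 2 * t ^ 2 * ‖v‖ ^ 2 with hh
  have hd : ∀ t, HasDerivAt h (inner ℝ (G (x + t • v) - G x) v - c * t * ‖v‖ ^ 2) t := by
    intro t
    have h1 : HasDerivAt (fun t : ℝ => x + t • v) v t := by
      simpa using ((hasDerivAt_id t).smul_const v).const_add x
    have h2 := (hG (x + t • v)).hasFDerivAt.comp_hasDerivAt t h1
    have h3 := (hasDerivAt_id t).mul_const (inner ℝ (G x) v)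
    have h4 := ((hasDerivAt_pow 2 t).const_mul (c / 2)).mul_const (‖v‖ ^ 2)
    refine ((h2.sub h3).sub h4).congr_deriv ?_
    rw [InnerProductSpace.toDual_apply_apply, inner_sub_left]
    push_cast
    ring
  have hmono : MonotoneOn h (Set.Icc 0 1) := by
    refine monotoneOn_of_deriv_nonneg (convex_Icc 0 1)
      (fun t _ => (hd t).continuousAt.continuousWithinAt)
      (fun t _ => (hd t).differentiableAt.differentiableWithinAt) fun t ht => ?_
    rw [interior_Icc] at ht
    rw [(hd t).deriv]
    have := hc (x + t • v) x
    rw [add_sub_cancel_left, norm_smul, inner_smul_right, Real.norm_of_nonneg ht.1.le] at this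
    nlinarith [ht.1]
  have := hmono (Set.left_mem_Icc.2 zero_le_one) (Set.right_mem_Icc.2 zero_le_one) zero_le_one
  simp only [hh, zero_smul, add_zero, one_smul] at this
  linarith

namespace StronglyConvexSmooth

variable (h : StronglyConvexSmooth φ m M)
include h

theorem M_pos : 0 < M := h.m_pos.trans_le h.m_le_M

theorem hasGradientAt (x : E d) : HasGradientAt φ (gradient φ x) x :=
  (h.differentiable x).hasGradientAt

theorem le_apply_add (x v : E d) :
    φ x + inner ℝ (gradient φ x) v + m / 2 * ‖v‖ ^ 2 ≤ φ (x + v) :=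
  quadratic_lower_bound h.hasGradientAt h.lower x v

theorem apply_add_le (x v : E d) :
    φ (x + v) ≤ φ x + inner ℝ (gradient φ x) v + M / 2 * ‖v‖ ^ 2 := by
  have hG : ∀ z, HasGradientAt (fun z => -φ z) (-gradient φ z) z := fun z => by
    rw [hasGradientAt_iff_hasFDerivAt, map_neg]
    exact (h.hasGradientAt z).hasFDerivAt.neg
  have := quadratic_lower_bound hG (c := -M) (fun x y => by
    have := h.upper x y
    rw [← neg_sub', inner_neg_left]
    linarith) x v
  rw [inner_neg_left] at this
  linarith

/-- Compare the lower bound from `x` and the upper bound from `y` at the gradient-step point `y -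
M⁻¹ u`. Symmetrizing gives cocoercivity, and from it the Lipschitz bound. -/
theorem cocoercive_aux (x y : E d) :
    φ x + inner ℝ (gradient φ x) (y - x) + ‖gradient φ y - gradient φ x‖ ^ 2 / (2 * M) ≤ φ y := by
  have hM := h.M_pos
  set u := gradient φ y - gradient φ x with hu
  have h1 := h.le_apply_add x (y - x - M⁻¹ • u)
  have h2 := h.apply_add_le y (-(M⁻¹ • u))
  have e : x + (y - x - M⁻¹ • u) = y + -(M⁻¹ • u) := by abel
  rw [e, inner_sub_right, inner_smul_right] at h1
  rw [inner_neg_right, inner_smul_right, norm_neg, norm_smul, Real.norm_of_nonneg (by positivity)]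
    at h2
  have h3 : inner ℝ (gradient φ y) u - inner ℝ (gradient φ x) u = ‖u‖ ^ 2 := by
    rw [← inner_sub_left, ← hu, real_inner_self_eq_norm_sq]
  have h4 : 0 ≤ m / 2 * ‖y - x - M⁻¹ • u‖ ^ 2 := by have := h.m_pos; positivity
  have h5 : M / 2 * (M⁻¹ * ‖u‖) ^ 2 = ‖u‖ ^ 2 / (2 * M) := by field_simp
  have h6 : M⁻¹ * inner ℝ (gradient φ y) u - M⁻¹ * inner ℝ (gradient φ x) u =
      2 * (‖u‖ ^ 2 / (2 * M)) := by rw [← mul_sub, h3]; field_simp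
  linarith

theorem cocoercive (x y : E d) :
    ‖gradient φ x - gradient φ y‖ ^ 2 ≤ M * inner ℝ (gradient φ x - gradient φ y) (x - y) := by
  have hM := h.M_pos
  have h1 := h.cocoercive_aux x y
  have h2 := h.cocoercive_aux y x
  rw [norm_sub_rev, ← neg_sub x y, inner_neg_right] at h1
  have h3 : ‖gradient φ x - gradient φ y‖ ^ 2 / M ≤
      inner ℝ (gradient φ x - gradient φ y) (x - y) := by
    rw [inner_sub_left]
    have : ‖gradient φ x - gradient φ y‖ ^ 2 / M =
      2 * (‖gradient φ x - gradient φ y‖ ^ 2 / (2 * M)) := by field_simp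
    linarith
  rwa [div_le_iff₀' hM] at h3

theorem norm_gradient_sub_le (x y : E d) :
    ‖gradient φ x - gradient φ y‖ ≤ M * ‖x - y‖ := by
  have h1 := h.cocoercive x y
  have h2 := mul_le_mul_of_nonneg_left (h.upper x y) h.M_pos.le
  refine le_of_sq_le_sq ?_ (mul_nonneg h.M_pos.le (norm_nonneg _))
  calc _ ≤ _ := h1.trans h2
    _ = _ := by ring

theorem mul_norm_sub_le (x y : E d) : m * ‖x - y‖ ≤ ‖gradient φ x - gradient φ y‖ := by
  have h1 := (h.lower x y).trans (real_inner_le_norm _ _)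
  rcases (norm_nonneg (x - y)).eq_or_lt with h0 | h0
  · rw [← h0, mul_zero]; exact norm_nonneg _
  · exact le_of_mul_le_mul_right (by linarith) h0

theorem continuous_gradient : Continuous (gradient φ) :=
  (LipschitzWith.of_dist_le_mul (K := ⟨M, h.M_pos.le⟩) fun x y => by
    rw [dist_eq_norm, dist_eq_norm]; exact h.norm_gradient_sub_le x y).continuous

theorem exists_minimizer : ∃ z, ∀ x, φ z ≤ φ x := by
  refine h.differentiable.continuous.exists_forall_le ?_
  have hm := h.m_pos
  have hlow : ∀ x : E d, φ 0 + ‖x‖ * (m / 2 * ‖x‖ - ‖gradient φ 0‖) ≤ φ x := fun x => by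
    have h1 := h.le_apply_add 0 x
    have h2 := neg_le_of_abs_le (abs_real_inner_le_norm (gradient φ 0) x)
    rw [zero_add] at h1
    nlinarith
  refine Filter.tendsto_atTop_mono hlow ?_
  refine Filter.tendsto_atTop_add_const_left _ _ ?_
  refine (tendsto_norm_cocompact_atTop (E := E d)).atTop_mul_atTop₀ ?_
  exact Filter.tendsto_atTop_add_const_right _ _
    ((tendsto_norm_cocompact_atTop (E := E d)).const_mul_atTop (by positivity))

theorem bddBelow_range : BddBelow (Set.range φ) := by
  obtain ⟨z, hz⟩ := h.exists_minimizer
  exact ⟨φ z, by rintro _ ⟨x, rfl⟩; exact hz x⟩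

/-- Polyak-Łojasiewicz inequality: minimize the quadratic lower bound. -/
theorem two_mul_sub_iInf_le (x : E d) :
    2 * m * (φ x - ⨅ z, φ z) ≤ ‖gradient φ x‖ ^ 2 := by
  obtain ⟨z, hz⟩ := h.exists_minimizer
  have hm := h.m_pos
  have h1 := h.le_apply_add x (z - x)
  rw [add_sub_cancel] at h1
  have h2 := neg_le_of_abs_le (abs_real_inner_le_norm (gradient φ x) (z - x))
  have h3 : φ z ≤ ⨅ z, φ z := le_ciInf hz
  nlinarith [sq_nonneg (‖gradient φ x‖ - m * ‖z - x‖)]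

theorem sq_norm_gradient_le (x : E d) :
    ‖gradient φ x‖ ^ 2 ≤ 2 * M * (φ x - ⨅ z, φ z) := by
  have hM := h.M_pos
  have h1 := h.apply_add_le x (-(M⁻¹ • gradient φ x))
  have h2 := ciInf_le h.bddBelow_range (x + -(M⁻¹ • gradient φ x))
  rw [inner_neg_right, inner_smul_right, norm_neg, norm_smul, Real.norm_of_nonneg (by positivity),
    real_inner_self_eq_norm_sq] at h1
  have h3 : M⁻¹ * ‖gradient φ x‖ ^ 2 - M / 2 * (M⁻¹ * ‖gradient φ x‖) ^ 2 =
      ‖gradient φ x‖ ^ 2 / (2 * M) := by field_simp; ring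
  have h4 : ‖gradient φ x‖ ^ 2 / (2 * M) ≤ φ x - ⨅ z, φ z := by linarith
  rwa [div_le_iff₀' (by positivity)] at h4

theorem isCompact_gradient_le (c : ℝ) : IsCompact {x | ‖gradient φ x‖ ≤ c} := by
  refine Metric.isCompact_of_isClosed_isBounded
    (isClosed_le h.continuous_gradient.norm continuous_const) ?_
  refine isBounded_iff_forall_norm_le.2 ⟨(c + ‖gradient φ 0‖) / m, fun x hx => ?_⟩
  rw [le_div_iff₀' h.m_pos]
  have h1 := h.mul_norm_sub_le x 0
  rw [sub_zero] at h1
  exact h1.trans ((norm_sub_le _ _).trans (add_le_add_left hx _))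

theorem exists_isMaxOn_gradient_le {c : ℝ} (hc : 0 ≤ c) :
    ∃ z ∈ {x | ‖gradient φ x‖ ≤ c}, IsMaxOn φ {x | ‖gradient φ x‖ ≤ c} z := by
  refine (h.isCompact_gradient_le c).exists_isMaxOn ?_ h.differentiable.continuous.continuousOn
  obtain ⟨z, hz⟩ := h.exists_minimizer
  refine ⟨z, ?_⟩
  have h1 := h.sq_norm_gradient_le z
  have h2 : φ z ≤ ⨅ z, φ z := le_ciInf hz
  have h3 : ‖gradient φ z‖ ^ 2 ≤ 0 := h1.trans
    (mul_nonpos_of_nonneg_of_nonpos (by have := h.M_pos; positivity) (by linarith))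
  have h4 : ‖gradient φ z‖ = 0 := by nlinarith [norm_nonneg (gradient φ z)]
  simpa [h4] using hc

end StronglyConvexSmooth

end Convex

/-! ### Correction pairs and the angle of the search direction. -/

section Angle

variable {d : ℕ}

theorem inner_eq_dotProduct (u v : E d) : inner ℝ u v = u.ofLp ⬝ᵥ v.ofLp := by
  rw [EuclideanSpace.inner_eq_star_dotProduct, dotProduct_comm, star_trivial]

theorem norm_sq_eq_dotProduct (u : E d) : ‖u‖ ^ 2 = u.ofLp ⬝ᵥ u.ofLp := by
  rw [← real_inner_self_eq_norm_sq, inner_eq_dotProduct]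

/-- The bounds on a correction pair under which the angle condition of Byrd and Nocedal holds. -/
def CurvaturePair (μ L : ℝ) (s y : E d) : Prop :=
  μ * ‖s‖ ^ 2 ≤ inner ℝ y s ∧ ‖y‖ ^ 2 ≤ L * inner ℝ y s

theorem CurvaturePair.eq_zero {μ L : ℝ} {s y : E d} (h : CurvaturePair μ L s y) (hs : s = 0) :
    y = 0 := by
  have := h.2
  rw [hs, inner_zero_right, mul_zero] at this
  exact norm_eq_zero.1 (by nlinarith [norm_nonneg y])

theorem exists_curvaturePair {φ f : E d → ℝ} {g : E d → E d} {m M εf εg c₃ : ℝ}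
    (hφ : StronglyConvexSmooth φ m M) (herr : BoundedErrors φ f g εf εg) (hc₃ : 0 < c₃) :
    ∃ μ L : ℝ, 0 < μ ∧ Real.log μ ≤ L ∧ ∀ (x p : E d) (β : ℝ), 0 < β →
      NoiseControl g c₃ εg x p β → CurvaturePair μ L (β • p) (g (x + β • p) - g x) := by
  have hm := hφ.m_pos
  have hM := hφ.M_pos
  have hεg := herr.εg_nonneg
  -- Noise control gives `uᵀs ≤ (2 + c₃) / (1 + c₃) * yᵀs`, hence `μ`. In `L`, `4 * M` comes from
  -- `2‖u‖²` and the other term from `8 * εg ^ 2`. Adding `|log μ|` makes the growth `L - log μ`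
  -- nonnegative.
  set μ := (1 + c₃) / (2 + c₃) * m with hμ
  set L := 4 * M + 2 * M / (c₃ * (1 + c₃)) with hL
  have hL0 : 0 ≤ L := by positivity
  refine ⟨μ, L + |Real.log μ|, by positivity,
    (le_abs_self _).trans (le_add_of_nonneg_left hL0), fun x p β hβ hN => ?_⟩
  set s := β • p with hs
  set y := g (x + s) - g x with hy
  set u := gradient φ (x + s) - gradient φ x with hu
  have hN' : 2 * (1 + c₃) * εg * ‖s‖ ≤ inner ℝ y s := by
    rw [hs, norm_smul, inner_smul_right, Real.norm_of_nonneg hβ.le]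
    have := mul_le_mul_of_nonneg_left hN hβ.le
    rw [← hs, ← hy] at this
    linarith
  have hyu : ‖y - u‖ ≤ 2 * εg := by
    have e : y - u = (gradient φ x - g x) - (gradient φ (x + s) - g (x + s)) := by
      rw [hy, hu]; abel
    rw [e]
    have g1 := herr.gradient_error x
    have g2 := herr.gradient_error (x + s)
    exact (norm_sub_le _ _).trans (by linarith)
  have habs : |inner ℝ y s - inner ℝ u s| ≤ 2 * εg * ‖s‖ := by
    rw [← inner_sub_left]
    exact (abs_real_inner_le_norm _ _).trans (mul_le_mul_of_nonneg_right hyu (norm_nonneg _))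
  have hlow : m * ‖s‖ ^ 2 ≤ inner ℝ u s := by simpa using hφ.lower (x + s) x
  have hupp : inner ℝ u s ≤ M * ‖s‖ ^ 2 := by simpa using hφ.upper (x + s) x
  have hcoc : ‖u‖ ^ 2 ≤ M * inner ℝ u s := by simpa using hφ.cocoercive (x + s) x
  obtain ⟨ha, hb⟩ := abs_le.1 habs
  set e := inner ℝ y s with he
  set t := inner ℝ u s with ht
  have hεs : 0 ≤ εg * ‖s‖ := by positivity
  have he0 : 0 ≤ e := le_trans (by positivity) hN'
  have h1 : (1 + c₃) * t ≤ (2 + c₃) * e := by nlinarith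
  have h2 : c₃ * e ≤ (1 + c₃) * t := by nlinarith
  have h3 : t ≤ 2 * e := by nlinarith
  constructor
  · rw [hμ, div_mul_eq_mul_div, div_mul_eq_mul_div, div_le_iff₀ (by positivity)]
    nlinarith
  · refine le_trans ?_ (mul_le_mul_of_nonneg_right (le_add_of_nonneg_right (abs_nonneg _)) he0)
    rcases (norm_nonneg s).eq_or_lt with h0 | h0
    · have : y = 0 := by simp [hy, norm_eq_zero.1 h0.symm]
      have hy2 : ‖y‖ ^ 2 = 0 := by rw [this]; simp
      rw [hy2]
      exact mul_nonneg hL0 he0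
    have h4 : 2 * c₃ * εg ≤ M * ‖s‖ := by
      have : (1 + c₃) * ‖s‖ * (2 * c₃ * εg) ≤ (1 + c₃) * ‖s‖ * (M * ‖s‖) := by nlinarith
      exact le_of_mul_le_mul_left this (by positivity)
    have h5 : εg ^ 2 * (4 * c₃ * (1 + c₃)) ≤ M * e := by
      have a1 := mul_le_mul_of_nonneg_left hN' hM.le
      have a2 := mul_le_mul_of_nonneg_left h4 (show 0 ≤ 2 * (1 + c₃) * εg by positivity)
      linarith
    have h6 : 8 * εg ^ 2 ≤ 2 * M / (c₃ * (1 + c₃)) * e := by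
      rw [div_mul_eq_mul_div, le_div_iff₀ (by positivity)]
      linarith
    have h7 : ‖y‖ ≤ ‖u‖ + 2 * εg := by
      have := norm_add_le u (y - u)
      rw [add_sub_cancel] at this
      linarith
    have h8 : ‖y‖ ^ 2 ≤ 2 * ‖u‖ ^ 2 + 8 * εg ^ 2 := by
      nlinarith [norm_nonneg y, sq_nonneg (‖u‖ - 2 * εg)]
    rw [hL]
    nlinarith

theorem bfgsUpdate_zero (H : Mat d) : bfgsUpdate H 0 0 = H := by
  simp [bfgsUpdate]

theorem bfgsUpdate_potential_le {H : Mat d} (hH : H.PosDef) {μ L : ℝ} (hμ : 0 < μ) {b s y : E d}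
    (hb : b ≠ 0) (hs : s.ofLp = H *ᵥ b.ofLp) (hp : CurvaturePair μ L s y) :
    0 < inner ℝ s b ∧ s ≠ 0 ∧ (bfgsUpdate H s y).PosDef ∧
      potential (bfgsUpdate H s y) ≤ potential H + (L - Real.log μ) +
        Real.log ((inner ℝ s b / (‖s‖ * ‖b‖)) ^ 2) := by
  have hb' : b.ofLp ≠ 0 := fun h => hb (by ext i; simp [h])
  have hσ : 0 < inner ℝ s b := by
    rw [inner_eq_dotProduct, hs, dotProduct_comm]
    simpa using hH.dotProduct_mulVec_pos hb'
  have hs0 : s ≠ 0 := fun h => by simp [h] at hσ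
  have h1 := hp.1
  have h2 := hp.2
  have hys : 0 < inner ℝ y s := lt_of_lt_of_le (by positivity) h1
  refine ⟨hσ, hs0, ?_, ?_⟩
  · rw [bfgsUpdate_eq]
    exact updateMatrix_posDef hH (by rwa [← inner_eq_dotProduct])
  · rw [norm_sq_eq_dotProduct, inner_eq_dotProduct, hs] at h1 h2
    rw [bfgsUpdate_eq, div_pow, mul_pow, norm_sq_eq_dotProduct, norm_sq_eq_dotProduct,
      inner_eq_dotProduct, hs]
    exact potential_update_le hH hb' hμ h1 h2

/-- Take `b = H⁻¹ s` and drop `log cos² ≤ 0`. The degenerate pair `s = y = 0`, which occurs once `g`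
vanishes, leaves `H` unchanged. -/
theorem bfgsUpdate_posDef_and_potential_le {H : Mat d} (hH : H.PosDef) {μ L : ℝ} (hμ : 0 < μ)
    (hL : Real.log μ ≤ L) {s y : E d} (hp : CurvaturePair μ L s y) :
    (bfgsUpdate H s y).PosDef ∧ potential (bfgsUpdate H s y) ≤ potential H + (L - Real.log μ) := by
  by_cases hs : s = 0
  · rw [hp.eq_zero hs, hs, bfgsUpdate_zero]
    exact ⟨hH, by linarith⟩
  · have hinv : H * H⁻¹ = 1 := mul_nonsing_inv _ ((isUnit_iff_isUnit_det H).1 hH.isUnit)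
    set b : E d := WithLp.toLp 2 (H⁻¹ *ᵥ s.ofLp) with hb
    have hsb : s.ofLp = H *ᵥ b.ofLp := by rw [hb, mulVec_mulVec, hinv, one_mulVec]
    have hb0 : b ≠ 0 := fun h => hs (by
      ext i
      rw [hsb, h]
      simp)
    obtain ⟨h1, -, h3, h4⟩ := bfgsUpdate_potential_le hH hμ hb0 hsb hp
    refine ⟨h3, h4.trans (add_le_of_nonpos_right (Real.log_nonpos (by positivity) ?_))⟩
    refine pow_le_one₀ (by positivity) ?_
    exact div_le_one_of_le₀ (real_inner_le_norm _ _) (by positivity)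

theorem cosAngle_zero_right (p : E d) : cosAngle p 0 = 1 := by
  simp [cosAngle]

theorem cosAngle_of_ne_zero (p : E d) {v : E d} (hv : v ≠ 0) :
    cosAngle p v = inner ℝ p (-v) / (‖p‖ * ‖v‖) := by
  rw [cosAngle, if_neg hv, InnerProductGeometry.cos_angle, norm_neg]

theorem cosAngle_le_one (p v : E d) : cosAngle p v ≤ 1 := by
  unfold cosAngle
  split_ifs
  exacts [le_rfl, Real.cos_le_one _]

theorem cosAngle_pos_and_potential_le {H : Mat d} (hH : H.PosDef) {μ L : ℝ} (hμ : 0 < μ)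
    (hL : Real.log μ ≤ L) {v p y : E d} (hpv : p = -Matrix.toEuclideanLin H v) {β : ℝ} (hβ : 0 < β)
    (hp : CurvaturePair μ L (β • p) y) :
    0 < cosAngle p v ∧ potential (bfgsUpdate H (β • p) y) ≤
      potential H + (L - Real.log μ) + 2 * Real.log (cosAngle p v) := by
  by_cases hv : v = 0
  · rw [hv, cosAngle_zero_right, Real.log_one, mul_zero, add_zero]
    exact ⟨one_pos, (bfgsUpdate_posDef_and_potential_le hH hμ hL hp).2⟩
  -- Here `b = -β v`, so the angle in the potential estimate is the one between `p` and `-v`.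
  · have hs : (β • p).ofLp = H *ᵥ (-(β • v)).ofLp := by
      rw [hpv]
      simp [Matrix.ofLp_toLpLin, mulVec_neg, mulVec_smul]
    obtain ⟨h1, h2, -, h4⟩ := bfgsUpdate_potential_le hH hμ
      (neg_ne_zero.2 (smul_ne_zero hβ.ne' hv)) hs hp
    have hp0 : p ≠ 0 := fun h => h2 (by rw [h, smul_zero])
    have e : inner ℝ (β • p) (-(β • v)) / (‖β • p‖ * ‖-(β • v)‖) = cosAngle p v := by
      have := norm_pos_iff.2 hp0
      have := norm_pos_iff.2 hv
      rw [cosAngle_of_ne_zero p hv, ← smul_neg, inner_smul_left, inner_smul_right, norm_smul,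
        norm_smul, norm_neg, Real.norm_of_nonneg hβ.le]
      simp only [conj_trivial]
      field_simp
    have hpos : 0 < cosAngle p v := by
      rw [← e]
      exact div_pos h1 (mul_pos (norm_pos_iff.2 h2)
        (norm_pos_iff.2 (neg_ne_zero.2 (smul_ne_zero hβ.ne' hv))))
    refine ⟨hpos, ?_⟩
    rw [e, Real.log_pow] at h4
    exact_mod_cast h4

theorem bfgsIterate_posDef_and_potential_le {H : Mat d} (hH : H.PosDef) {μ L : ℝ} (hμ : 0 < μ)
    (hL : Real.log μ ≤ L) {s y : ℕ → E d} (hp : ∀ i, CurvaturePair μ L (s i) (y i)) (n : ℕ) :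
    (bfgsIterate H s y n).PosDef ∧
      potential (bfgsIterate H s y n) ≤ potential H + n * (L - Real.log μ) := by
  induction n with
  | zero => exact ⟨hH, by simp [bfgsIterate]⟩
  | succ n ih =>
    obtain ⟨h1, h2⟩ := bfgsUpdate_posDef_and_potential_le ih.1 hμ hL (hp n)
    refine ⟨h1, h2.trans ?_⟩
    push_cast
    linarith [ih.2]

/-- The bound does not depend on `k`: the initial scaling `c` has `1 / c ≤ L` and, by
Cauchy-Schwarz, `c ≤ 1 / μ`, and at most `t` updates follow. -/
theorem lbfgsMatrix_posDef_and_potential_le {t : ℕ} {μ L : ℝ} (hμ : 0 < μ)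
    (hL : Real.log μ ≤ L) {s y : ℕ → E d} (hp : ∀ i, CurvaturePair μ L (s i) (y i)) {k : ℕ}
    (hs : s (k - 1) ≠ 0) :
    (lbfgsMatrix t s y k).PosDef ∧
      potential (lbfgsMatrix t s y k) ≤ (d + t) * (L - Real.log μ) := by
  obtain ⟨h1, h2⟩ := hp (k - 1)
  set u := s (k - 1)
  set w := y (k - 1)
  have hys : 0 < inner ℝ w u := lt_of_lt_of_le (by positivity) h1
  have hw : w ≠ 0 := fun h => by simp [h] at hys
  have hww : 0 < inner ℝ w w := real_inner_self_pos.2 hw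
  have hc : 0 < inner ℝ u w / inner ℝ w w := by rw [real_inner_comm]; positivity
  have hpd : ((inner ℝ u w / inner ℝ w w : ℝ) • (1 : Mat d)).PosDef := PosDef.one.smul hc
  obtain ⟨h3, h4⟩ := bfgsIterate_posDef_and_potential_le hpd hμ hL
    (fun i => hp (k - min t k + i)) (min t k)
  refine ⟨h3, h4.trans ?_⟩
  rw [potential_smul_one hc, Fintype.card_fin, add_mul]
  have e1 : (inner ℝ u w / inner ℝ w w)⁻¹ ≤ L := by
    rw [inv_div, real_inner_comm w u, div_le_iff₀ hys, real_inner_self_eq_norm_sq]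
    exact h2
  have e2 : Real.log (inner ℝ u w / inner ℝ w w) ≤ -Real.log μ := by
    rw [← Real.log_inv]
    refine Real.log_le_log hc ?_
    rw [real_inner_comm, div_le_iff₀ hww, inv_mul_eq_div, le_div_iff₀ hμ,
      real_inner_self_eq_norm_sq]
    have cs := real_inner_mul_inner_self_le w u
    rw [real_inner_self_eq_norm_sq, real_inner_self_eq_norm_sq] at cs
    have h5 := mul_le_mul_of_nonneg_right h1 (sq_nonneg ‖w‖)
    have h6 := mul_le_mul_of_nonneg_left cs hμ.le
    refine le_of_mul_le_mul_left ?_ hys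
    linarith
  have e3 : ((min t k : ℕ) : ℝ) ≤ t := by exact_mod_cast min_le_left _ _
  have e4 := mul_le_mul_of_nonneg_right e3 (sub_nonneg.2 hL)
  have e5 : (d : ℝ) * ((inner ℝ u w / inner ℝ w w)⁻¹ + Real.log (inner ℝ u w / inner ℝ w w)) ≤
      d * (L - Real.log μ) := mul_le_mul_of_nonneg_left (by linarith) (Nat.cast_nonneg d)
  linarith

end Angle

/-! ### From a linear bound on the log-cosines to a fraction of good indices. -/

theorem exists_pos_fraction_le {a : ℕ → ℝ} {D q : ℝ} (ha : ∀ k, 0 < a k) (ha1 : ∀ k, a k ≤ 1)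
    (hD : 0 ≤ D) (hq : q < 1) (hsum : ∀ k : ℕ, -∑ j ∈ Finset.range k, Real.log (a j) ≤ D * k) :
    ∃ γ : ℝ, 0 < γ ∧ ∀ k : ℕ, q * (k : ℝ) ≤ (({j | γ ≤ a j} ∩ Set.Iio k).ncard : ℝ) := by
  have hq' : 0 < 1 - q := by linarith
  -- Markov: at most `D k / T ≤ (1 - q) k` indices have `-log a > T`. The `+ 1` keeps `T` positive.
  set T := (D + 1) / (1 - q) with hT
  have hT0 : 0 < T := by positivity
  have hTD : T * (1 - q) = D + 1 := by rw [hT]; field_simp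
  refine ⟨Real.exp (-T), Real.exp_pos _, fun k => ?_⟩
  have e : ({j | Real.exp (-T) ≤ a j} ∩ Set.Iio k) =
      (((Finset.range k).filter fun j => Real.exp (-T) ≤ a j : Finset ℕ) : Set ℕ) := by
    ext j; simp [and_comm]
  rw [e, Set.ncard_coe_finset, ← Finset.sum_boole]
  set S : ℝ := ∑ j ∈ Finset.range k, if Real.exp (-T) ≤ a j then (1 : ℝ) else 0 with hS
  have h1 : (k : ℝ) * T - S * T ≤ -∑ j ∈ Finset.range k, Real.log (a j) := by
    have : (k : ℝ) * T - S * T = ∑ j ∈ Finset.range k,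
        (T - (if Real.exp (-T) ≤ a j then (1 : ℝ) else 0) * T) := by
      rw [Finset.sum_sub_distrib, ← Finset.sum_mul, Finset.sum_const, Finset.card_range,
        nsmul_eq_mul]
    rw [this, ← Finset.sum_neg_distrib]
    refine Finset.sum_le_sum fun j _ => ?_
    split_ifs with hj
    · have := Real.log_nonpos (ha j).le (ha1 j)
      linarith
    · have := (Real.log_lt_iff_lt_exp (ha j)).2 (not_le.1 hj)
      linarith
  have h2 := h1.trans (hsum k)
  have h3 : (k : ℝ) * (T * (1 - q)) = k * (D + 1) := by rw [hTD]
  have hk : (0 : ℝ) ≤ k := Nat.cast_nonneg k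
  refine le_of_mul_le_mul_right ?_ hT0
  linarith

/-! ### Good iterates, decrease of `f` and linear convergence. -/

section Run

variable {d : ℕ} {φ f : E d → ℝ} {g : E d → E d} {m M εf εg c₁ c₂ c₃ : ℝ}
  {x p : ℕ → E d} {α β : ℕ → ℝ} {s y : ℕ → E d} {H : ℕ → Mat d}

theorem IsRun.p_eq_zero (h : IsRun f g c₁ c₂ c₃ εg x p α β s y H) {k : ℕ} (hk : g (x k) = 0) :
    p k = 0 := by
  rw [h.direction, hk, map_zero, neg_zero]

theorem IsRun.gradient_succ_eq_zero (h : IsRun f g c₁ c₂ c₃ εg x p α β s y H) {k : ℕ}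
    (hk : g (x k) = 0) : g (x (k + 1)) = 0 := by
  rw [h.step, h.p_eq_zero hk, smul_zero, add_zero, hk]

theorem IsRun.exists_goodFraction_of_isBFGS (h : IsRun f g c₁ c₂ c₃ εg x p α β s y H)
    (hB : IsBFGS H s y) {μ L : ℝ} (hμ : 0 < μ) (hL : Real.log μ ≤ L)
    (hp : ∀ k, CurvaturePair μ L (s k) (y k)) {q : ℝ} (hq : q < 1) :
    (∀ k, g (x k) = 0 ∨ (H k).PosDef) ∧ ∃ γ : ℝ, 0 < γ ∧ GoodFraction g x p q γ := by
  have hpd : ∀ k, (H k).PosDef := fun k => by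
    induction k with
    | zero => exact h.H_zero
    | succ k ih =>
      rw [hB k]
      exact (bfgsUpdate_posDef_and_potential_le ih hμ hL (hp k)).1
  have hstep : ∀ k, 0 < cosAngle (p k) (g (x k)) ∧ potential (H (k + 1)) ≤
      potential (H k) + (L - Real.log μ) + 2 * Real.log (cosAngle (p k) (g (x k))) := fun k => by
    have hk := hp k
    rw [h.pair_s] at hk
    have := cosAngle_pos_and_potential_le (hpd k) hμ hL (h.direction k) (h.β_pos k) hk
    rwa [← h.pair_s, ← hB k] at this
  have hsum : ∀ k : ℕ, potential (H k) ≤ potential (H 0) + k * (L - Real.log μ) +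
      2 * ∑ j ∈ Finset.range k, Real.log (cosAngle (p j) (g (x j))) := fun k => by
    induction k with
    | zero => simp
    | succ k ih =>
      rw [Finset.sum_range_succ]
      push_cast
      linarith [(hstep k).2]
  have h0 := potential_nonneg h.H_zero
  refine ⟨fun k => Or.inr (hpd k), exists_pos_fraction_le
    -- The initial potential is absorbed into the slope, since `k ≥ 1` outside the trivial case.
    (D := potential (H 0) + (L - Real.log μ)) (fun k => (hstep k).1)
    (fun k => cosAngle_le_one _ _) (by linarith) hq fun k => ?_⟩
  rcases Nat.eq_zero_or_pos k with rfl | hk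
  · simp
  have hk1 : (1 : ℝ) ≤ k := by exact_mod_cast hk
  have h1 := hsum k
  have h2 := potential_nonneg (hpd k)
  have h3 := mul_le_mul_of_nonneg_left hk1 h0
  have h4 := mul_nonneg (sub_nonneg.2 hL) (Nat.cast_nonneg (α := ℝ) k)
  have h5 := mul_nonneg h0 (Nat.cast_nonneg (α := ℝ) k)
  linarith

/-- One hypothetical further update of `H k` has nonnegative potential, so the uniform bound `C`
limits `-log cos θ` at every iterate. The alternative `g (x k) = 0` is needed because the initial
scaling degenerates after a zero step. -/
theorem IsRun.exists_goodFraction_of_isLBFGS (h : IsRun f g c₁ c₂ c₃ εg x p α β s y H)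
    {t : ℕ} (hB : IsLBFGS t H s y) {μ L : ℝ} (hμ : 0 < μ) (hL : Real.log μ ≤ L)
    (hp : ∀ k, CurvaturePair μ L (s k) (y k)) {q : ℝ} (hq : q < 1) :
    (∀ k, g (x k) = 0 ∨ (H k).PosDef) ∧ ∃ γ : ℝ, 0 < γ ∧ GoodFraction g x p q γ := by
  set C := max (potential (H 0)) ((d + t) * (L - Real.log μ)) with hC
  have hangle : ∀ k, (H k).PosDef → 0 < cosAngle (p k) (g (x k)) ∧ 0 ≤
      potential (H k) + (L - Real.log μ) + 2 * Real.log (cosAngle (p k) (g (x k))) :=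
    fun k hk => by
      have hk' := hp k
      rw [h.pair_s] at hk'
      obtain ⟨h1, h2⟩ := cosAngle_pos_and_potential_le hk hμ hL (h.direction k) (h.β_pos k) hk'
      exact ⟨h1, (potential_nonneg
        (bfgsUpdate_posDef_and_potential_le hk hμ hL hk').1).trans h2⟩
  have hpd : ∀ k, g (x k) = 0 ∨ ((H k).PosDef ∧ potential (H k) ≤ C) := fun k => by
    induction k with
    | zero => exact Or.inr ⟨h.H_zero, le_max_left _ _⟩
    | succ k ih =>
      by_cases hk : g (x k) = 0
      · exact Or.inl (h.gradient_succ_eq_zero hk)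
      · right
        have hpos := (hangle k (ih.resolve_left hk).1).1
        have hpk : p k ≠ 0 := fun h0 => by
          rw [cosAngle_of_ne_zero _ hk, h0, inner_zero_left, zero_div] at hpos
          exact lt_irrefl _ hpos
        rw [hB (k + 1) (Nat.le_add_left _ _)]
        have hs : s (k + 1 - 1) ≠ 0 := by
          rw [Nat.add_sub_cancel, h.pair_s]
          exact smul_ne_zero (h.β_pos k).ne' hpk
        obtain ⟨h1, h2⟩ := lbfgsMatrix_posDef_and_potential_le (t := t) hμ hL hp hs
        exact ⟨h1, h2.trans (le_max_right _ _)⟩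
  have hC0 : 0 ≤ C := (potential_nonneg h.H_zero).trans (le_max_left _ _)
  refine ⟨fun k => (hpd k).imp_right And.left, Real.exp (-((C + (L - Real.log μ)) / 2)),
    Real.exp_pos _, fun k => ?_⟩
  have hall : goodIterates g x p (Real.exp (-((C + (L - Real.log μ)) / 2))) = Set.univ := by
    refine Set.eq_univ_of_forall fun k => ?_
    rcases hpd k with hk | ⟨h1, h2⟩
    · change _ ≤ cosAngle _ _
      rw [hk, cosAngle_zero_right]
      exact Real.exp_le_one_iff.2 (by linarith)
    · obtain ⟨h3, h4⟩ := hangle k h1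
      exact (Real.le_log_iff_exp_le h3).1 (by linarith)
  rw [hall, Set.univ_inter, ← Finset.coe_range, Set.ncard_coe_finset, Finset.card_range]
  exact mul_le_of_le_one_left (Nat.cast_nonneg k) hq.le

theorem IsRun.exists_goodFraction (h : IsRun f g c₁ c₂ c₃ εg x p α β s y H)
    (hφ : StronglyConvexSmooth φ m M) (herr : BoundedErrors φ f g εf εg) (hc₃ : 0 < c₃)
    {q : ℝ} (hq : q < 1) :
    (∀ k, g (x k) = 0 ∨ (H k).PosDef) ∧ ∃ γ : ℝ, 0 < γ ∧ GoodFraction g x p q γ := by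
  obtain ⟨μ, L, hμ, hL, hpair⟩ := exists_curvaturePair hφ herr hc₃
  have hp : ∀ k, CurvaturePair μ L (s k) (y k) := fun k => by
    rw [h.pair_s, h.pair_y]
    exact hpair _ _ _ (h.β_pos k) (h.lengthening k)
  rcases h.update with hB | ⟨t, -, hB⟩
  exacts [h.exists_goodFraction_of_isBFGS hB hμ hL hp hq,
    h.exists_goodFraction_of_isLBFGS hB hμ hL hp hq]

theorem IsRun.antitone (h : IsRun f g c₁ c₂ c₃ εg x p α β s y H) (hc₁ : 0 ≤ c₁)
    (hH : ∀ k, g (x k) = 0 ∨ (H k).PosDef) : Antitone fun k => f (x k) := by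
  refine antitone_nat_of_succ_le fun k => ?_
  rw [h.step]
  rcases h.line_search k with ⟨hA, -⟩ | hk
  · refine hA.trans (add_le_of_nonpos_right (mul_nonpos_of_nonneg_of_nonpos
      (mul_nonneg hc₁ (h.α_nonneg k)) ?_))
    rcases hH k with hk | hk
    · rw [hk, inner_zero_left]
    · rw [h.direction, inner_neg_right, inner_eq_dotProduct, Matrix.ofLp_toLpLin,
        Matrix.toLin'_apply, neg_nonpos]
      simpa using hk.posSemidef.dotProduct_mulVec_nonneg (g (x k)).ofLp
  · exact hk

/-- For `k = 1` the count is positive, so index `0` is good. -/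
theorem GoodFraction.le_one {q γ : ℝ} (hq : 0 < q) (h : GoodFraction g x p q γ) : γ ≤ 1 := by
  have h1 := h 1
  have hne : (goodIterates g x p γ ∩ Set.Iio 1).Nonempty := by
    refine Set.nonempty_of_ncard_ne_zero fun h0 => ?_
    rw [h0] at h1
    push_cast at h1
    linarith
  obtain ⟨k, hk, -⟩ := hne
  exact le_trans hk (cosAngle_le_one _ _)

theorem armijo_wolfe_decrease (hφ : StronglyConvexSmooth φ m M)
    (herr : BoundedErrors φ f g εf εg) (hc₁ : 0 < c₁) (hc₂ : c₂ < 1) (hc₂0 : 0 < c₂) {γ : ℝ}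
    (hγ : 0 < γ) {x p : E d} {α : ℝ} (hα : 0 ≤ α) (hangle : γ ≤ cosAngle p (g x))
    (hx : x ∉ N₁ φ M c₁ c₂ εf εg γ) (hA : Armijo f g c₁ x p α) (hW : Wolfe g c₂ x p α) :
    f (x + α • p) ≤ f x - c₁ * (1 - c₂) * γ ^ 2 / (2 * M) * ‖gradient φ x‖ ^ 2 := by
  have hM := hφ.M_pos
  have hεg := herr.εg_nonneg
  have hγ1 : γ ≤ 1 := hangle.trans (cosAngle_le_one _ _)
  have hc : 0 < 1 - c₂ := by linarith
  have hx' : constB c₁ c₂ * εg / γ < ‖gradient φ x‖ :=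
    (le_max_right _ _).trans_lt (not_le.1 hx)
  have hE' : 8 / (1 - c₂) * εg / γ < ‖gradient φ x‖ := by
    refine lt_of_le_of_lt ?_ hx'
    have : 8 / (1 - c₂) ≤ constB c₁ c₂ := le_max_left _ _
    gcongr
  have hG0 : 0 < ‖gradient φ x‖ := lt_of_le_of_lt (by positivity) hE'
  have hn : ‖gradient φ x‖ ≤ ‖g x‖ + εg := by
    have h1 := herr.gradient_error x
    have h2 := norm_add_le (g x) (gradient φ x - g x)
    rw [add_sub_cancel] at h2
    linarith
  have hlip : ‖g (x + α • p) - g x‖ ≤ M * (α * ‖p‖) + 2 * εg := by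
    have h1 := herr.gradient_error x
    have h2 := herr.gradient_error (x + α • p)
    have h3 := hφ.norm_gradient_sub_le (x + α • p) x
    rw [add_sub_cancel_left, norm_smul, Real.norm_of_nonneg hα] at h3
    have e : g (x + α • p) - g x = (gradient φ (x + α • p) - gradient φ x) +
        ((gradient φ x - g x) - (gradient φ (x + α • p) - g (x + α • p))) := by abel
    rw [e]
    have h4 := norm_add_le (gradient φ (x + α • p) - gradient φ x)
      ((gradient φ x - g x) - (gradient φ (x + α • p) - g (x + α • p)))
    have h5 := norm_sub_le (gradient φ x - g x) (gradient φ (x + α • p) - g (x + α • p))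
    linarith
  set G := ‖gradient φ x‖
  have hE : 8 * εg ≤ (1 - c₂) * (γ * G) := by
    rw [div_mul_eq_mul_div, div_div, div_lt_iff₀ (by positivity)] at hE'
    linarith
  have hγG : γ * G ≤ G := mul_le_of_le_one_left hG0.le hγ1
  have hn7 : 7 / 8 * G ≤ ‖g x‖ := by
    have : (1 - c₂) * (γ * G) ≤ 1 * G := mul_le_mul (by linarith) hγG (by positivity) zero_le_one
    linarith
  have hgx : g x ≠ 0 := norm_pos_iff.1 (lt_of_lt_of_le (by positivity) hn7)
  have hθ0 : 0 < cosAngle p (g x) := hγ.trans_le hangle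
  have hp0 : p ≠ 0 := fun h0 => by
    rw [cosAngle_of_ne_zero _ hgx, h0, inner_zero_left, zero_div] at hθ0
    exact lt_irrefl _ hθ0
  have hP := norm_pos_iff.2 hp0
  have hgn := norm_pos_iff.2 hgx
  have hinner : inner ℝ (g x) p = -(‖g x‖ * ‖p‖ * cosAngle p (g x)) := by
    rw [cosAngle_of_ne_zero _ hgx, inner_neg_right, real_inner_comm]
    field_simp
  rw [Armijo, hinner] at hA
  rw [Wolfe, hinner] at hW
  set n := ‖g x‖
  set P := ‖p‖
  set θ := cosAngle p (g x)
  have h1 : inner ℝ (g (x + α • p)) p + n * P * θ ≤ (M * (α * P) + 2 * εg) * P := by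
    have : inner ℝ (g (x + α • p)) p + n * P * θ = inner ℝ (g (x + α • p) - g x) p := by
      rw [inner_sub_left, hinner]
      ring
    rw [this]
    exact (real_inner_le_norm _ _).trans (mul_le_mul_of_nonneg_right hlip hP.le)
  have h2 : (1 - c₂) * (n * θ) ≤ M * (α * P) + 2 * εg := by
    refine le_of_mul_le_mul_right ?_ hP
    linarith
  have hnθ : 7 / 8 * (γ * G) ≤ n * θ := by
    have := mul_le_mul hn7 hangle hγ.le hgn.le
    linarith
  -- Outside `N₁`, `2 * εg` is at most `1/4` of `(1 - c₂) γ G`, hence `2/7` of `(1 - c₂) n θ`. Next,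
  -- `5/7 * (7/8)² ≥ 1/2`.
  have h3 : 5 / 7 * ((1 - c₂) * (n * θ)) ≤ M * (α * P) := by
    have := mul_le_mul_of_nonneg_left hnθ hc.le
    linarith
  have h4 : 1 / 2 * ((1 - c₂) * (γ * G) ^ 2) ≤ M * (α * P) * (n * θ) := by
    have a1 := mul_le_mul_of_nonneg_right h3 (show 0 ≤ n * θ by positivity)
    have a2 := pow_le_pow_left₀ (by positivity) hnθ 2
    have a3 := mul_le_mul_of_nonneg_left a2 hc.le
    have a4 : 0 ≤ (1 - c₂) * (γ * G) ^ 2 := by positivity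
    linarith
  have h5 : c₁ * (1 - c₂) * γ ^ 2 / (2 * M) * G ^ 2 ≤ c₁ * (α * P * (n * θ)) := by
    rw [div_mul_eq_mul_div, div_le_iff₀ (by positivity)]
    have := mul_le_mul_of_nonneg_left h4 hc₁.le
    linarith
  linarith

theorem sub_iInf_le_of_forall_notMem (hφ : StronglyConvexSmooth φ m M)
    (herr : BoundedErrors φ f g εf εg) (hc₁ : 0 < c₁) (hc₁' : c₁ < 1) (hc₂ : c₂ < 1) (hc₂0 : 0 < c₂)
    (hα : ∀ k, 0 ≤ α k) (hstep : ∀ k, x (k + 1) = x k + α k • p k)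
    (hanti : Antitone fun k => f (x k)) {q γ : ℝ} (hq : 0 < q) (hγ : 0 < γ)
    (hgood : GoodFraction g x p q γ)
    (hls : ∀ k ∈ goodIterates g x p γ, x k ∉ N₁ φ M c₁ c₂ εf εg γ →
      Armijo f g c₁ (x k) (p k) (α k) ∧ Wolfe g c₂ (x k) (p k) (α k)) :
    ∃ ρ : ℝ, 0 < ρ ∧ ρ < 1 ∧ ∀ k : ℕ, (∀ j < k, x j ∉ N₁ φ M c₁ c₂ εf εg γ) →
      φ (x k) - (⨅ z, φ z) ≤ ρ ^ k * (φ (x 0) - ⨅ z, φ z) + 2 * εf := by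
  have hM := hφ.M_pos
  have hm := hφ.m_pos
  have hγ1 := hgood.le_one hq
  have hc : 0 < 1 - c₂ := by linarith
  have hferr : ∀ z, φ z - εf ≤ f z ∧ f z ≤ φ z + εf := fun z => by
    obtain ⟨h1, h2⟩ := abs_le.1 (herr.function_error z)
    constructor <;> linarith
  have hΔ : 0 ≤ φ (x 0) - ⨅ z, φ z := sub_nonneg.2 (ciInf_le hφ.bddBelow_range _)
  set φs := ⨅ z, φ z
  set κ := c₁ * (1 - c₂) * γ ^ 2 * m / M with hκ
  have hκ0 : 0 < κ := by positivity
  have hκ1 : κ < 1 := by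
    rw [hκ, div_lt_one hM]
    have a1 : c₁ * (1 - c₂) < 1 := by nlinarith
    have a2 : γ ^ 2 ≤ 1 := pow_le_one₀ hγ.le hγ1
    have a3 : c₁ * (1 - c₂) * γ ^ 2 < 1 :=
      (mul_le_of_le_one_right (by positivity) a2).trans_lt a1
    nlinarith [hφ.m_le_M]
  have h1κ : 0 < 1 - κ := by linarith
  set S : ℕ → ℕ := fun k => (goodIterates g x p γ ∩ Set.Iio k).ncard with hS
  have hSsucc : ∀ k, k ∈ goodIterates g x p γ → S (k + 1) = S k + 1 := fun k hk => by
    have : goodIterates g x p γ ∩ Set.Iio (k + 1) =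
        insert k (goodIterates g x p γ ∩ Set.Iio k) := by
      ext j
      simp only [Set.mem_inter_iff, Set.mem_Iio, Set.mem_insert_iff, Order.lt_add_one_iff,
        le_iff_eq_or_lt]
      constructor
      · tauto
      · rintro (rfl | h)
        exacts [⟨hk, Or.inl rfl⟩, ⟨h.1, Or.inr h.2⟩]
    rw [hS]
    simp only [this]
    exact Set.ncard_insert_of_notMem (by simp) ((Set.finite_Iio k).inter_of_right _)
  have hSbad : ∀ k, k ∉ goodIterates g x p γ → S (k + 1) = S k := fun k hk => by
    have : goodIterates g x p γ ∩ Set.Iio (k + 1) = goodIterates g x p γ ∩ Set.Iio k := by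
      ext j
      simp only [Set.mem_inter_iff, Set.mem_Iio, Order.lt_add_one_iff, le_iff_eq_or_lt]
      constructor
      · rintro ⟨h1, rfl | h2⟩
        exacts [absurd h1 hk, ⟨h1, h2⟩]
      · tauto
    rw [hS]
    simp only [this]
  -- Since `φ ≥ f - εf`, the decrease `κ (φ - φ*)` contracts `f - φ* - εf` by `1 - κ` without an
  -- additive error.
  have hind : ∀ k, (∀ j < k, x j ∉ N₁ φ M c₁ c₂ εf εg γ) →
      f (x k) - φs - εf ≤ (1 - κ) ^ S k * (φ (x 0) - φs) := fun k => by
    induction k with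
    | zero =>
      intro _
      have : S 0 = 0 := by simp [hS]
      rw [this, pow_zero, one_mul]
      linarith [(hferr (x 0)).2]
    | succ k ih =>
      intro hk
      have ih' := ih fun j hj => hk j (hj.trans k.lt_succ_self)
      by_cases hkg : k ∈ goodIterates g x p γ
      · have hxk := hk k k.lt_succ_self
        obtain ⟨hA, hW⟩ := hls k hkg hxk
        have hdec := armijo_wolfe_decrease hφ herr hc₁ hc₂ hc₂0 hγ (hα k) hkg hxk hA hW
        rw [← hstep] at hdec
        have hPL := hφ.two_mul_sub_iInf_le (x k)
        have e : c₁ * (1 - c₂) * γ ^ 2 / (2 * M) * (2 * m * (φ (x k) - φs)) =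
            κ * (φ (x k) - φs) := by
          rw [hκ]; field_simp
        have h1 := mul_le_mul_of_nonneg_left hPL
          (show 0 ≤ c₁ * (1 - c₂) * γ ^ 2 / (2 * M) by positivity)
        rw [e] at h1
        have h2 := mul_le_mul_of_nonneg_left (hferr (x k)).2 hκ0.le
        have h3 := mul_le_mul_of_nonneg_left ih' h1κ.le
        rw [hSsucc k hkg, pow_succ]
        linarith
      · rw [hSbad k hkg]
        have : f (x (k + 1)) ≤ f (x k) := hanti k.le_succ
        linarith
  -- At least `q k` contractions happen in `k` steps.
  refine ⟨(1 - κ) ^ q, Real.rpow_pos_of_pos h1κ _,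
    Real.rpow_lt_one h1κ.le (by linarith) hq, fun k hk => ?_⟩
  have h1 : (1 - κ) ^ S k ≤ ((1 - κ) ^ q) ^ k := by
    rw [← Real.rpow_natCast, ← Real.rpow_natCast, ← Real.rpow_mul h1κ.le]
    exact Real.rpow_le_rpow_of_exponent_ge h1κ (by linarith) (hgood k)
  have h2 := mul_le_mul_of_nonneg_right h1 hΔ
  linarith [hind k hk, (hferr (x k)).1]

end Run

/-! ### Entry time and threshold of `N₁`. -/

section FirstEntry

variable {d : ℕ} {x : ℕ → E d} {N : Set (E d)}

theorem firstEntry_le {k : ℕ} (hk : x k ∈ N) : firstEntry x N ≤ k :=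
  sInf_le ⟨k, hk, rfl⟩

theorem exists_mem_of_firstEntry_le {k : ℕ} (h : firstEntry x N ≤ k) : ∃ j ≤ k, x j ∈ N := by
  by_contra! hj
  have : ((k + 1 : ℕ) : ℕ∞) ≤ firstEntry x N := by
    refine le_sInf ?_
    rintro _ ⟨j, hjN, rfl⟩
    exact Nat.cast_le.2 (not_le.1 fun hle => hj j hle hjN)
  exact absurd (Nat.cast_le.1 (this.trans h)) (Nat.not_succ_le_self k)

end FirstEntry

/-- As `c₁ (1 - c₂) ≤ 1` and `γ ≤ 1`, the first term of the maximum is at least `8 √(M εf)`. For `εf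
= 0` the second term is positive. -/
theorem sq_threshold_gt {M c₁ c₂ εf εg γ : ℝ} (hM : 0 < M) (hc₁ : 0 < c₁) (hc₁₂ : c₁ < c₂)
    (hc₂ : c₂ < 1) (hεf : 0 ≤ εf) (hγ : 0 < γ) (hγ1 : γ ≤ 1)
    (hε : 0 < εf ∨ 0 < εg) :
    4 * M * εf < (max (constA c₁ c₂ * √(M * εf) / γ) (constB c₁ c₂ * εg / γ)) ^ 2 := by
  have hc : 0 < 1 - c₂ := by linarith
  rcases hεf.eq_or_lt with h0 | h0
  · have hεg' : 0 < εg := hε.resolve_left (by linarith)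
    have hB : 0 < constB c₁ c₂ := lt_of_lt_of_le (by positivity) (le_max_left _ _)
    have : 0 < max (constA c₁ c₂ * √(M * εf) / γ) (constB c₁ c₂ * εg / γ) :=
      lt_of_lt_of_le (by positivity) (le_max_right _ _)
    rw [← h0] at this ⊢
    rw [mul_zero]
    positivity
  · have hA : 8 ≤ constA c₁ c₂ := by
      refine le_trans ?_ (le_max_right _ _)
      have : √(c₁ * (1 - c₂)) ≤ 1 := Real.sqrt_le_one.2 (by nlinarith)
      rw [le_div_iff₀ (Real.sqrt_pos.2 (by positivity))]
      linarith
    have h1 : 8 * √(M * εf) ≤ constA c₁ c₂ * √(M * εf) / γ := by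
      rw [le_div_iff₀ hγ]
      have := mul_le_mul_of_nonneg_right hA (Real.sqrt_nonneg (M * εf))
      have := mul_le_of_le_one_right (show 0 ≤ 8 * √(M * εf) by positivity) hγ1
      linarith
    have h2 := pow_le_pow_left₀ (by positivity) (h1.trans (le_max_left _ (constB c₁ c₂ * εg / γ))) 2
    rw [mul_pow, Real.sq_sqrt (by positivity)] at h2
    have : 0 < M * εf := by positivity
    linarith

end NoisyBFGS

/-! ### The main theorem. -/

theorem mainTheorem1 {d : ℕ} (φ f : NoisyBFGS.E d → ℝ) (g : NoisyBFGS.E d → NoisyBFGS.E d)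
    (m M εf εg c₁ c₂ c₃ : ℝ)
    (hφ : NoisyBFGS.StronglyConvexSmooth φ m M)
    (herr : NoisyBFGS.BoundedErrors φ f g εf εg)
    (hc₁ : 0 < c₁) (hc₁₂ : c₁ < c₂) (hc₂ : c₂ < 1) (hc₃ : 0 < c₃)
    (x p : ℕ → NoisyBFGS.E d) (α β : ℕ → ℝ) (s y : ℕ → NoisyBFGS.E d) (H : ℕ → NoisyBFGS.Mat d)
    (hrun : NoisyBFGS.IsRun f g c₁ c₂ c₃ εg x p α β s y H)
    (q : ℝ) (hq₀ : 0 < q) (hq₁ : q < 1) :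
    (∃ γ : ℝ, 0 < γ ∧ NoisyBFGS.GoodFraction g x p q γ) ∧
    ∀ γ : ℝ, 0 < γ → NoisyBFGS.GoodFraction g x p q γ →
      ∀ N₁ N₂ : Set (NoisyBFGS.E d), N₁ = NoisyBFGS.N₁ φ M c₁ c₂ εf εg γ →
        N₂ = NoisyBFGS.N₂ φ εf N₁ →
      (∀ k ∈ NoisyBFGS.goodIterates g x p γ, x k ∉ N₁ →
        NoisyBFGS.Armijo f g c₁ (x k) (p k) (α k) ∧ NoisyBFGS.Wolfe g c₂ (x k) (p k) (α k)) →
      (∃ z ∈ N₁, IsMaxOn φ N₁ z) ∧ N₁ ⊆ N₂ ∧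
      (∃ ρ : ℝ, 0 < ρ ∧ ρ < 1 ∧ ∀ k : ℕ, (k : ℕ∞) < NoisyBFGS.firstEntry x N₁ →
        φ (x k) - (⨅ z, φ z) ≤ ρ ^ k * (φ (x 0) - ⨅ z, φ z) + 2 * εf) ∧
      (0 < εf ∨ 0 < εg → NoisyBFGS.firstEntry x N₁ < ⊤) ∧
      ∀ k : ℕ, NoisyBFGS.firstEntry x N₁ ≤ (k : ℕ∞) → x k ∈ N₂ := by
  obtain ⟨hH, hex⟩ := hrun.exists_goodFraction hφ herr hc₃ hq₁
  refine ⟨hex, ?_⟩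
  rintro γ hγ hgood N₁ N₂ hN₁ rfl hls
  have hM := hφ.M_pos
  have hεf := herr.εf_nonneg
  have hεg := herr.εg_nonneg
  have hc : 0 < 1 - c₂ := by linarith
  have hanti := hrun.antitone hc₁.le hH
  obtain ⟨ρ, hρ0, hρ1, hρ⟩ := NoisyBFGS.sub_iInf_le_of_forall_notMem hφ herr hc₁ (hc₁₂.trans hc₂) hc₂
    (hc₁.trans hc₁₂) hrun.α_nonneg hrun.step hanti hq₀ hγ hgood (by rwa [← hN₁])
  rw [← hN₁] at hρ
  have hB : 0 ≤ NoisyBFGS.constB c₁ c₂ := le_trans (by positivity) (le_max_left _ _)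
  obtain ⟨z, hz, hmax⟩ := hφ.exists_isMaxOn_gradient_le
    (c := max (NoisyBFGS.constA c₁ c₂ * √(M * εf) / γ) (NoisyBFGS.constB c₁ c₂ * εg / γ))
    (le_max_of_le_right (by positivity))
  have hzN : z ∈ N₁ := hN₁ ▸ hz
  have hmaxN : IsMaxOn φ N₁ z := hN₁ ▸ hmax
  have hle : ∀ w ∈ N₁, φ w ≤ sSup (φ '' N₁) := fun w hw =>
    le_csSup ⟨φ z, by rintro _ ⟨v, hv, rfl⟩; exact hmaxN hv⟩ ⟨w, hw, rfl⟩
  refine ⟨⟨z, hzN, hmaxN⟩, fun w hw => ?_, ⟨ρ, hρ0, hρ1, fun k hk => hρ k fun j hj hjN => ?_⟩,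
    fun hε => ?_, fun k hk => ?_⟩
  · have := hle w hw
    change φ w ≤ 2 * εf + _
    linarith
  · exact absurd (Nat.cast_le.2 hj.le) (not_le.2 (hk.trans_le (NoisyBFGS.firstEntry_le hjN)))
  · rw [lt_top_iff_ne_top]
    intro htop
    have hnot : ∀ j, x j ∉ N₁ := fun j hj => by
      have := NoisyBFGS.firstEntry_le hj
      rw [htop] at this
      exact absurd this (by simp)
    have hτ := NoisyBFGS.sq_threshold_gt hM hc₁ hc₁₂ hc₂ hεf hγ (hgood.le_one hq₀) hε
    set τ := max (NoisyBFGS.constA c₁ c₂ * √(M * εf) / γ) (NoisyBFGS.constB c₁ c₂ * εg / γ)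
    have hτ0 : 0 ≤ τ := le_max_of_le_right (by positivity)
    have hbound : ∀ k, τ ^ 2 ≤ 2 * M * (ρ ^ k * (φ (x 0) - ⨅ z, φ z) + 2 * εf) := fun k => by
      have h1 : τ < ‖gradient φ (x k)‖ := by
        have := hnot k
        rw [hN₁] at this
        exact not_le.1 this
      calc τ ^ 2 ≤ ‖gradient φ (x k)‖ ^ 2 := pow_le_pow_left₀ hτ0 h1.le 2
        _ ≤ 2 * M * (φ (x k) - ⨅ z, φ z) := hφ.sq_norm_gradient_le _
        _ ≤ _ := mul_le_mul_of_nonneg_left (hρ k fun j _ => hnot j) (by positivity)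
    have hlim : Filter.Tendsto (fun k : ℕ => 2 * M * (ρ ^ k * (φ (x 0) - ⨅ z, φ z) + 2 * εf))
        Filter.atTop (nhds (2 * M * (0 * (φ (x 0) - ⨅ z, φ z) + 2 * εf))) :=
      (((tendsto_pow_atTop_nhds_zero_of_lt_one hρ0.le hρ1).mul_const _).add_const _).const_mul _
    -- The limit gives `τ ^ 2 ≤ 4 * M * εf`, contradicting `hτ`.
    have := ge_of_tendsto' hlim hbound
    linarith
  · obtain ⟨j, hjk, hj⟩ := NoisyBFGS.exists_mem_of_firstEntry_le hk
    have h1 : f (x k) ≤ f (x j) := hanti hjk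
    have h2 := (abs_le.1 (herr.function_error (x k))).2
    have h3 := (abs_le.1 (herr.function_error (x j))).1
    have h4 := hle _ hj
    change φ (x k) ≤ 2 * εf + _
    linarith
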